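/- Consider the perturbed double pendulum $$\theta_1''=-2\theta_1+\theta_2+\varepsilon F_1,\qquad \theta_2''=2\theta_1-2\theta_2+\varepsilon F_2,$$ where the prime denotes $d/d\tau$, with $F_1=0$ and $F_2=(1-\theta_1^2)\sin\left(\sqrt{2-\sqrt2}\,\tau\right)$. Put $T_1=2\pi/\sqrt{2-\sqrt2}$ and, for $(X_0,Y_0)\in\mathbb R^2$, let $\theta^{(X_0,Y_0)}(\tau)$ be the pair of functions $$\left(\frac{X_0\cos(\sqrt{2-\sqrt2}\,\tau)+Y_0\sin(\sqrt{2-\sqrt2}\,\tau)}{\sqrt{4-2\sqrt2}},\ \frac{X_0\cos(\sqrt{2-\sqrt2}\,\tau)+Y_0\sin(\sqrt{2-\sqrt2}\,\tau)}{\sqrt{2-\sqrt2}}\right).$$ For $(X_0^*,Y_0^*)=\left(2\sqrt{2(2-\sqrt2)},\,0\right)$ and for $(X_0^*,Y_0^*)=\left(0,\,2\sqrt{\tfrac23(2-\sqrt2)}\right)$ the pair $\theta^{(X_0^*,Y_0^*)}$ is a nonconstant $T_1$-periodic solution of the unperturbed system ($\varepsilon=0$). Moreover, there is $\varepsilon_0>0$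 such that for every $\varepsilon$ with $0<|\varepsilon|<\varepsilon_0$ the perturbed system has (at least) two nonconstant $T_1$-periodic solutions $\alpha(\cdot,\varepsilon)$ and $\beta(\cdot,\varepsilon)$, defined for all $\tau\in\mathbb R$ and not time translates of each other (in particular distinct), such that, as $\varepsilon\to0$, $\varepsilon\ne0$, $\alpha(\cdot,\varepsilon)$ tends to the orbit $\theta^{(X_0^*,Y_0^*)}$ with the first value of $(X_0^*,Y_0^*)$ and $\beta(\cdot,\varepsilon)$ tends to the one with the second value; here angles and angular velocities converge uniformly in $\tau\in\mathbb R$. -/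

import Mathlib

namespace DoublePendulum

/-- `(θ₁, θ₂)`, defined for all times, solves the perturbed double pendulum
`θ₁'' = -2 θ₁ + θ₂ + ε F₁(τ, θ₁, θ₁', θ₂, θ₂')`,
`θ₂'' = 2 θ₁ - 2 θ₂ + ε F₂(τ, θ₁, θ₁', θ₂, θ₂')`.
For `ε = 0` this is the unperturbed double pendulum. -/
def IsSolution (F₁ F₂ : ℝ → ℝ → ℝ → ℝ → ℝ → ℝ) (ε : ℝ) (θ₁ θ₂ : ℝ → ℝ) : Prop :=
  Differentiable ℝ θ₁ ∧ Differentiable ℝ θ₂ ∧ ∀ τ : ℝ,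
    HasDerivAt (deriv θ₁)
      (-2 * θ₁ τ + θ₂ τ + ε * F₁ τ (θ₁ τ) (deriv θ₁ τ) (θ₂ τ) (deriv θ₂ τ)) τ ∧
    HasDerivAt (deriv θ₂)
      (2 * θ₁ τ - 2 * θ₂ τ + ε * F₂ τ (θ₁ τ) (deriv θ₁ τ) (θ₂ τ) (deriv θ₂ τ)) τ

/-- A `T`-periodic solution of the perturbed double pendulum; as usual, constant solutions
(equilibria) are not counted as periodic solutions. -/
def IsPeriodicSolution (F₁ F₂ : ℝ → ℝ → ℝ → ℝ → ℝ → ℝ) (ε T : ℝ) (θ₁ θ₂ : ℝ → ℝ) : Prop :=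
  0 < T ∧ IsSolution F₁ F₂ ε θ₁ θ₂ ∧ Function.Periodic θ₁ T ∧ Function.Periodic θ₂ T ∧
    ¬ ∃ a b : ℝ, ∀ τ : ℝ, θ₁ τ = a ∧ θ₂ τ = b

/-- The slow frequency `√(2 - √2)` of the unperturbed double pendulum. -/
noncomputable def slowFreq : ℝ := √(2 - √2)

/-- The slow period `T₁ = 2π / √(2 - √2)`. -/
noncomputable def slowPeriod : ℝ := 2 * Real.pi / slowFreq

/-- First angle of the slow-mode orbit of the unperturbed double pendulum with
parameters `(X₀, Y₀)`. -/
noncomputable def slowOrbit₁ (X₀ Y₀ τ : ℝ) : ℝ :=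
  1 / √(4 - 2 * √2) * (X₀ * Real.cos (slowFreq * τ) + Y₀ * Real.sin (slowFreq * τ))

/-- Second angle of the slow-mode orbit of the unperturbed double pendulum with
parameters `(X₀, Y₀)`. -/
noncomputable def slowOrbit₂ (X₀ Y₀ τ : ℝ) : ℝ :=
  1 / √(2 - √2) * (X₀ * Real.cos (slowFreq * τ) + Y₀ * Real.sin (slowFreq * τ))

/-- The family `(θ₁ ε, θ₂ ε)` tends, as `ε → 0` with `ε ≠ 0`, to the slow-mode orbit with
parameters `(X₀, Y₀)`: angles and angular velocities converge uniformly in time. -/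
def TendsToSlowOrbit (θ₁ θ₂ : ℝ → ℝ → ℝ) (X₀ Y₀ : ℝ) : Prop :=
  TendstoUniformly θ₁ (slowOrbit₁ X₀ Y₀) (nhdsWithin 0 {0}ᶜ) ∧
  TendstoUniformly (fun ε => deriv (θ₁ ε)) (deriv (slowOrbit₁ X₀ Y₀)) (nhdsWithin 0 {0}ᶜ) ∧
  TendstoUniformly θ₂ (slowOrbit₂ X₀ Y₀) (nhdsWithin 0 {0}ᶜ) ∧
  TendstoUniformly (fun ε => deriv (θ₂ ε)) (deriv (slowOrbit₂ X₀ Y₀)) (nhdsWithin 0 {0}ᶜ)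

/-- The perturbation `F₁ = 0`. -/
def pert₁ (_τ _θ₁ _v₁ _θ₂ _v₂ : ℝ) : ℝ := 0

/-- The perturbation `F₂ = (1 - θ₁²) sin(√(2 - √2) τ)`. -/
noncomputable def pert₂ (τ θ₁ _v₁ _θ₂ _v₂ : ℝ) : ℝ :=
  (1 - θ₁ ^ 2) * Real.sin (√(2 - √2) * τ)

end DoublePendulum

namespace DoublePendulum

open MeasureTheory Topology Filter

theorem continuous_coe_lift {T : ℝ} (f : C(AddCircle T, ℝ)) :
    Continuous fun t : ℝ => f (t : AddCircle T) :=
  f.continuous.comp (AddCircle.continuous_mk' T)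

section Convolution

variable {T : ℝ} [hT : Fact (0 < T)]

/-- Integral over one period `∫₀ᵀ g(s) f(x - s) ds` as a bounded operator on continuous
`T`-periodic functions. The kernel `g` need not be periodic. -/
noncomputable def periodicConv (g : C(ℝ, ℝ)) : C(AddCircle T, ℝ) →L[ℝ] C(AddCircle T, ℝ) :=
  LinearMap.mkContinuous
    { toFun := fun f =>
        ⟨fun x => ∫ s in (0 : ℝ)..T, g s * f (x - (s : AddCircle T)), by
          apply intervalIntegral.continuous_parametric_intervalIntegral_of_continuous'
          have h1 : Continuous fun p : AddCircle T × ℝ => (p.2 : AddCircle T) :=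
            (AddCircle.continuous_mk' T).comp continuous_snd
          exact (g.continuous.comp continuous_snd).mul
            (f.continuous.comp (continuous_fst.sub h1))⟩
      map_add' := fun f₁ f₂ => by
        ext x
        have hi (f : C(AddCircle T, ℝ)) :
            Continuous fun s : ℝ => g s * f (x - (s : AddCircle T)) :=
          g.continuous.mul
            (f.continuous.comp (continuous_const.sub (AddCircle.continuous_mk' T)))
        simp only [ContinuousMap.coe_mk, ContinuousMap.add_apply, mul_add]
        exact intervalIntegral.integral_add ((hi f₁).intervalIntegrable _ _) ((hi f₂).intervalIntegrable _ _)
      map_smul' := fun c f => by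
        ext x
        simp only [ContinuousMap.coe_mk, ContinuousMap.smul_apply, smul_eq_mul, RingHom.id_apply]
        rw [← intervalIntegral.integral_const_mul]
        congr 1
        ext s
        ring }
    (∫ s in (0 : ℝ)..T, |g s|) fun f => by
      rw [ContinuousMap.norm_le _ (mul_nonneg
        (intervalIntegral.integral_nonneg hT.out.le fun s _ => abs_nonneg _) (norm_nonneg _))]
      intro x
      rw [← intervalIntegral.integral_mul_const]
      refine intervalIntegral.norm_integral_le_of_norm_le hT.out.le (ae_of_all _ fun s _ => ?_)
        ((g.continuous.abs.mul continuous_const).intervalIntegrable _ _)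
      rw [norm_mul]
      exact mul_le_mul_of_nonneg_left (f.norm_coe_le_norm _) (abs_nonneg _)

theorem periodicConv_apply (g : C(ℝ, ℝ)) (f : C(AddCircle T, ℝ)) (x : AddCircle T) :
    periodicConv g f x = ∫ s in (0 : ℝ)..T, g s * f (x - (s : AddCircle T)) := rfl

theorem periodicConv_coe (g : C(ℝ, ℝ)) (f : C(AddCircle T, ℝ)) (t : ℝ) :
    periodicConv g f (t : AddCircle T) =
      ∫ s in (0 : ℝ)..T, g s * f ((t - s : ℝ) : AddCircle T) := rfl

theorem hasDerivAt_periodicConv {g g' : C(ℝ, ℝ)} (hg : ∀ s, HasDerivAt g (g' s) s)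
    (f : C(AddCircle T, ℝ)) (t : ℝ) :
    HasDerivAt (fun t : ℝ => periodicConv g f (t : AddCircle T))
      (periodicConv g' f (t : AddCircle T) + (g 0 - g T) * f (t : AddCircle T)) t := by
  set F : ℝ → ℝ := fun t => f (t : AddCircle T) with hF
  have hFc : Continuous F := continuous_coe_lift f
  set H : ℝ → ℝ := fun t => ∫ s in (0 : ℝ)..t, F s with hH
  have hHd (t : ℝ) : HasDerivAt H (F t) t := (hFc.integral_hasStrictDerivAt 0 t).hasDerivAt
  have hHc : Continuous H := continuous_iff_continuousAt.2 fun t => (hHd t).continuousAt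
  have hparts (t : ℝ) : periodicConv g f (t : AddCircle T) =
      g 0 * H t - g T * H (t - T) + ∫ s in (0 : ℝ)..T, g' s * H (t - s) := by
    have hv (s : ℝ) : HasDerivAt (fun s => - H (t - s)) (F (t - s)) s := 
      ((hHd (t - s)).comp_const_sub t s).neg.congr_deriv (neg_neg _)
    have key := intervalIntegral.integral_mul_deriv_eq_deriv_mul (a := 0) (b := T) (u := g) (u' := g')
      (v := fun s => - H (t - s)) (v' := fun s => F (t - s))
      (fun s _ => hg s) (fun s _ => hv s) (g'.continuous.intervalIntegrable _ _)
      ((hFc.comp (continuous_const.sub continuous_id)).intervalIntegrable _ _)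
    rw [periodicConv_coe]
    refine key.trans ?_
    simp only [mul_neg, intervalIntegral.integral_neg, sub_zero]
    ring
  have hmain : HasDerivAt (fun t : ℝ => ∫ s in (0 : ℝ)..T, g' s * H (t - s))
      (∫ s in (0 : ℝ)..T, g' s * F (t - s)) t := by
    refine (intervalIntegral.hasDerivAt_integral_of_dominated_loc_of_deriv_le (s := Set.univ)
      (F := fun t s => g' s * H (t - s)) (F' := fun t s => g' s * F (t - s))
      (bound := fun s => |g' s| * ‖f‖) univ_mem ?_ ?_ ?_ ?_ ?_ ?_).2
    · exact Eventually.of_forall fun t =>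
        (g'.continuous.mul (hHc.comp (continuous_const.sub continuous_id))).aestronglyMeasurable
    · exact (g'.continuous.mul
        (hHc.comp (continuous_const.sub continuous_id))).intervalIntegrable _ _
    · exact (g'.continuous.mul
        (hFc.comp (continuous_const.sub continuous_id))).aestronglyMeasurable
    · refine ae_of_all _ fun s _ t _ => ?_
      rw [norm_mul]
      exact mul_le_mul_of_nonneg_left (f.norm_coe_le_norm _) (abs_nonneg _)
    · exact (g'.continuous.abs.mul continuous_const).intervalIntegrable _ _
    · refine ae_of_all _ fun s _ t _ => ?_
      simpa using ((hHd (t - s)).comp_sub_const t s).const_mul (g' s)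
  have hper : F (t - T) = F t := by
    simp [hF, AddCircle.coe_period]
  have h2 : HasDerivAt (fun t => H (t - T)) (F (t - T)) t := 
    (hHd (t - T)).comp_sub_const t T
  have h3 := (((hHd t).const_mul (g 0)).sub (h2.const_mul (g T))).add hmain
  rw [hper] at h3
  refine (h3.congr_of_eventuallyEq (Eventually.of_forall fun t => hparts t)).congr_deriv ?_
  rw [periodicConv_coe]
  ring

/-- For a periodic kernel the integral may be centred at the evaluation point. -/
theorem periodicConv_coe_of_periodic {g : C(ℝ, ℝ)} (hg : Function.Periodic g T)
    (f : C(AddCircle T, ℝ)) (t : ℝ) :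
    periodicConv g f (t : AddCircle T) =
      ∫ s in (0 : ℝ)..T, g (s + t) * f ((-s : ℝ) : AddCircle T) := by
  have hp : Function.Periodic (fun s => g s * f ((t - s : ℝ) : AddCircle T)) T := fun s => by
    have : ((t - (s + T) : ℝ) : AddCircle T) = ((t - s : ℝ) : AddCircle T) := by
      rw [← sub_sub]; simp
    simp only [hg s, this]
  have h1 := hp.intervalIntegral_add_eq 0 t
  rw [periodicConv_coe]
  rw [zero_add, add_comm t T] at h1
  rw [h1]
  have h2 := intervalIntegral.integral_comp_add_right (a := 0) (b := T)
    (fun s => g s * f ((t - s : ℝ) : AddCircle T)) t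
  rw [zero_add] at h2
  rw [← h2]
  congr 1
  ext s
  rw [show t - (s + t) = -s by ring]

end Convolution

section Frequencies

theorem sqrt_two_mul_self : √2 * √2 = (2 : ℝ) := Real.mul_self_sqrt (by norm_num)

theorem sqrt_two_lt_two : √2 < (2 : ℝ) := by
  nlinarith [sqrt_two_mul_self, Real.sqrt_nonneg 2]

theorem slowFreq_sq : slowFreq ^ 2 = 2 - √2 :=
  Real.sq_sqrt (by linarith [sqrt_two_lt_two])

theorem slowFreq_pos : 0 < slowFreq := Real.sqrt_pos.2 (by linarith [sqrt_two_lt_two])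

theorem slowFreq_ne_zero : slowFreq ≠ 0 := slowFreq_pos.ne'

theorem slowPeriod_pos : 0 < slowPeriod := div_pos (by positivity) slowFreq_pos

instance fact_slowPeriod_pos : Fact (0 < slowPeriod) := ⟨slowPeriod_pos⟩

theorem slowFreq_mul_slowPeriod : slowFreq * slowPeriod = 2 * Real.pi :=
  mul_div_cancel₀ _ slowFreq_ne_zero

/-- The fast frequency `√(2 + √2) = (1 + √2) √(2 - √2)` of the unperturbed double pendulum. -/
noncomputable def fastFreq : ℝ := (1 + √2) * slowFreq

theorem fastFreq_sq : fastFreq ^ 2 = 2 + √2 := by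
  rw [fastFreq, mul_pow, slowFreq_sq]
  linear_combination -√2 * sqrt_two_mul_self

theorem fastFreq_pos : 0 < fastFreq := mul_pos (by positivity) slowFreq_pos

/-- Non-resonance of the fast mode with the slow period. -/
theorem sin_fastFreq_mul_half_slowPeriod_ne_zero : Real.sin (fastFreq * (slowPeriod / 2)) ≠ 0 := by
  have h : fastFreq * (slowPeriod / 2) = (1 + √2) * Real.pi := by
    rw [fastFreq]
    linear_combination (1 + √2) / 2 * slowFreq_mul_slowPeriod
  rw [h, Ne, Real.sin_eq_zero_iff]
  rintro ⟨n, hn⟩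
  have h1 : (n : ℝ) = 1 + √2 := mul_right_cancel₀ Real.pi_ne_zero hn
  exact irrational_sqrt_two ⟨n - 1, by push_cast; linarith⟩

end Frequencies

section Modes

theorem periodic_cos_slowFreq : Function.Periodic (fun t => Real.cos (slowFreq * t)) slowPeriod :=
  fun t => by simp only [mul_add, slowFreq_mul_slowPeriod, Real.cos_add_two_pi]

theorem periodic_sin_slowFreq : Function.Periodic (fun t => Real.sin (slowFreq * t)) slowPeriod :=
  fun t => by simp only [mul_add, slowFreq_mul_slowPeriod, Real.sin_add_two_pi]

/-- `cos(ω t)` as a function on the circle of length `2π/ω`, `ω` the slow frequency. -/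
noncomputable def cosCircle : C(AddCircle slowPeriod, ℝ) where
  toFun := periodic_cos_slowFreq.lift
  continuous_toFun := continuous_coinduced_dom.2 (by fun_prop :
    Continuous fun t => Real.cos (slowFreq * t))

/-- `sin(ω t)` as a function on the circle of length `2π/ω`, `ω` the slow frequency. -/
noncomputable def sinCircle : C(AddCircle slowPeriod, ℝ) where
  toFun := periodic_sin_slowFreq.lift
  continuous_toFun := continuous_coinduced_dom.2 (by fun_prop :
    Continuous fun t => Real.sin (slowFreq * t))

@[simp] theorem cosCircle_coe (t : ℝ) :
    cosCircle (t : AddCircle slowPeriod) = Real.cos (slowFreq * t) := rfl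

@[simp] theorem sinCircle_coe (t : ℝ) :
    sinCircle (t : AddCircle slowPeriod) = Real.sin (slowFreq * t) := rfl

theorem hasDerivAt_cos_mul (w t : ℝ) :
    HasDerivAt (fun t => Real.cos (w * t)) (-(w * Real.sin (w * t))) t := by
  have := (Real.hasDerivAt_cos (w * t)).comp t ((hasDerivAt_id t).const_mul w)
  exact this.congr_deriv (by ring)

theorem hasDerivAt_sin_mul (w t : ℝ) :
    HasDerivAt (fun t => Real.sin (w * t)) (w * Real.cos (w * t)) t := by
  have := (Real.hasDerivAt_sin (w * t)).comp t ((hasDerivAt_id t).const_mul w)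
  exact this.congr_deriv (by ring)

end Modes

section Kernels

/-- The kernel `cos(ω s)`. -/
noncomputable def cosKernel : C(ℝ, ℝ) := ⟨fun s => Real.cos (slowFreq * s), by fun_prop⟩

/-- The kernel `sin(ω s)`. -/
noncomputable def sinKernel : C(ℝ, ℝ) := ⟨fun s => Real.sin (slowFreq * s), by fun_prop⟩

/-- Generalized Green kernel of the (resonant) slow oscillator `u'' + ω² u = h`. -/
noncomputable def slowKernel : C(ℝ, ℝ) :=
  ⟨fun s => (1 - s / slowPeriod) * Real.sin (slowFreq * s) / slowFreq, by fun_prop⟩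

/-- Derivative of `slowKernel`. -/
noncomputable def slowKernelDeriv : C(ℝ, ℝ) :=
  ⟨fun s => (1 - s / slowPeriod) * Real.cos (slowFreq * s)
    - Real.sin (slowFreq * s) / (slowPeriod * slowFreq), by fun_prop⟩

/-- Green kernel of the fast oscillator `v'' + Ω² v = h` with slow period. -/
noncomputable def fastKernel : C(ℝ, ℝ) :=
  ⟨fun s => Real.cos (fastFreq * (s - slowPeriod / 2)) /
    (2 * fastFreq * Real.sin (fastFreq * (slowPeriod / 2))), by fun_prop⟩

/-- Derivative of `fastKernel`. -/
noncomputable def fastKernelDeriv : C(ℝ, ℝ) :=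
  ⟨fun s => -Real.sin (fastFreq * (s - slowPeriod / 2)) /
    (2 * Real.sin (fastFreq * (slowPeriod / 2))), by fun_prop⟩

theorem hasDerivAt_slowKernel (s : ℝ) : HasDerivAt slowKernel (slowKernelDeriv s) s := by
  have h := ((((hasDerivAt_id s).div_const slowPeriod).const_sub 1).mul
    (hasDerivAt_sin_mul slowFreq s)).div_const slowFreq
  refine h.congr_deriv ?_
  have := slowFreq_ne_zero
  have := slowPeriod_pos.ne'
  simp only [slowKernelDeriv, ContinuousMap.coe_mk, id]
  field_simp
  ring

theorem hasDerivAt_slowKernelDeriv (s : ℝ) : HasDerivAt slowKernelDeriv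
    ((-slowFreq ^ 2 • slowKernel - (2 / slowPeriod) • cosKernel) s) s := by
  have h := ((((hasDerivAt_id s).div_const slowPeriod).const_sub 1).mul
    (hasDerivAt_cos_mul slowFreq s)).sub
    ((hasDerivAt_sin_mul slowFreq s).div_const (slowPeriod * slowFreq))
  refine h.congr_deriv ?_
  have := slowFreq_ne_zero
  have := slowPeriod_pos.ne'
  simp only [slowKernel, cosKernel, ContinuousMap.coe_mk, ContinuousMap.sub_apply,
    ContinuousMap.smul_apply, smul_eq_mul, id]
  field_simp
  ring

theorem hasDerivAt_fastKernel (s : ℝ) : HasDerivAt fastKernel (fastKernelDeriv s) s := by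
  have h := ((hasDerivAt_cos_mul fastFreq (s - slowPeriod / 2)).comp_sub_const s
    (slowPeriod / 2)).div_const (2 * fastFreq * Real.sin (fastFreq * (slowPeriod / 2)))
  refine h.congr_deriv ?_
  have := fastFreq_pos.ne'
  have := sin_fastFreq_mul_half_slowPeriod_ne_zero
  simp only [fastKernelDeriv, ContinuousMap.coe_mk]
  field_simp

theorem hasDerivAt_fastKernelDeriv (s : ℝ) : HasDerivAt fastKernelDeriv
    ((-fastFreq ^ 2 • fastKernel) s) s := by
  have h := ((hasDerivAt_sin_mul fastFreq (s - slowPeriod / 2)).comp_sub_const s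
    (slowPeriod / 2)).neg.div_const (2 * Real.sin (fastFreq * (slowPeriod / 2)))
  refine h.congr_deriv ?_
  have := fastFreq_pos.ne'
  have := sin_fastFreq_mul_half_slowPeriod_ne_zero
  simp only [fastKernel, ContinuousMap.coe_mk, ContinuousMap.smul_apply, smul_eq_mul]
  field_simp

end Kernels

section Oscillators

theorem periodicConv_smul_kernel {T : ℝ} [Fact (0 < T)] (c : ℝ) (g : C(ℝ, ℝ))
    (f : C(AddCircle T, ℝ)) (x : AddCircle T) :
    periodicConv (c • g) f x = c * periodicConv g f x := by
  simp only [periodicConv_apply, ContinuousMap.smul_apply, smul_eq_mul, mul_assoc,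
    intervalIntegral.integral_const_mul]

theorem periodicConv_sub_kernel {T : ℝ} [Fact (0 < T)] (g₁ g₂ : C(ℝ, ℝ))
    (f : C(AddCircle T, ℝ)) (x : AddCircle T) :
    periodicConv (g₁ - g₂) f x = periodicConv g₁ f x - periodicConv g₂ f x := by
  have hi (g : C(ℝ, ℝ)) : Continuous fun s : ℝ => g s * f (x - (s : AddCircle T)) :=
    g.continuous.mul (f.continuous.comp (continuous_const.sub (AddCircle.continuous_mk' T)))
  simp only [periodicConv_apply, ContinuousMap.sub_apply, sub_mul]
  exact intervalIntegral.integral_sub ((hi g₁).intervalIntegrable _ _)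
    ((hi g₂).intervalIntegrable _ _)

/-- The cosine coefficient of the reflected function. -/
noncomputable def cosCoeff : C(AddCircle slowPeriod, ℝ) →L[ℝ] ℝ :=
  (ContinuousMap.evalCLM ℝ (0 : AddCircle slowPeriod)).comp (periodicConv cosKernel)

/-- The sine coefficient of the reflected function. -/
noncomputable def sinCoeff : C(AddCircle slowPeriod, ℝ) →L[ℝ] ℝ :=
  (ContinuousMap.evalCLM ℝ (0 : AddCircle slowPeriod)).comp (periodicConv sinKernel)

theorem cosCoeff_apply (f : C(AddCircle slowPeriod, ℝ)) : cosCoeff f =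
    ∫ s in (0 : ℝ)..slowPeriod, Real.cos (slowFreq * s) * f ((-s : ℝ) : AddCircle slowPeriod) := by
  have := periodicConv_coe cosKernel f 0
  simp only [zero_sub] at this
  exact this

theorem sinCoeff_apply (f : C(AddCircle slowPeriod, ℝ)) : sinCoeff f =
    ∫ s in (0 : ℝ)..slowPeriod, Real.sin (slowFreq * s) * f ((-s : ℝ) : AddCircle slowPeriod) := by
  have := periodicConv_coe sinKernel f 0
  simp only [zero_sub] at this
  exact this

theorem periodicConv_cosKernel (f : C(AddCircle slowPeriod, ℝ)) (t : ℝ) :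
    periodicConv cosKernel f (t : AddCircle slowPeriod) =
      Real.cos (slowFreq * t) * cosCoeff f - Real.sin (slowFreq * t) * sinCoeff f := by
  have hf : Continuous fun s : ℝ => f ((-s : ℝ) : AddCircle slowPeriod) :=
    (continuous_coe_lift f).comp continuous_neg
  rw [periodicConv_coe_of_periodic (g := cosKernel) periodic_cos_slowFreq, cosCoeff_apply,
    sinCoeff_apply, ← intervalIntegral.integral_const_mul, ← intervalIntegral.integral_const_mul,
    ← intervalIntegral.integral_sub]
  · congr 1
    ext s
    simp only [cosKernel, ContinuousMap.coe_mk, mul_add, Real.cos_add]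
    ring
  · exact Continuous.intervalIntegrable (by fun_prop) _ _
  · exact Continuous.intervalIntegrable (by fun_prop) _ _

variable (h : C(AddCircle slowPeriod, ℝ))

theorem hasDerivAt_slowResponse (t : ℝ) :
    HasDerivAt (fun t : ℝ => periodicConv slowKernel h (t : AddCircle slowPeriod))
      (periodicConv slowKernelDeriv h (t : AddCircle slowPeriod)) t := by
  refine (hasDerivAt_periodicConv hasDerivAt_slowKernel h t).congr_deriv ?_
  have : slowPeriod / slowPeriod = 1 := div_self slowPeriod_pos.ne'
  simp [slowKernel, this]

theorem hasDerivAt_slowResponseDeriv (hc : cosCoeff h = 0) (hs : sinCoeff h = 0) (t : ℝ) :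
    HasDerivAt (fun t : ℝ => periodicConv slowKernelDeriv h (t : AddCircle slowPeriod))
      (h (t : AddCircle slowPeriod) -
        slowFreq ^ 2 * periodicConv slowKernel h (t : AddCircle slowPeriod)) t := by
  refine (hasDerivAt_periodicConv (g' := -slowFreq ^ 2 • slowKernel - (2 / slowPeriod) • cosKernel)
    hasDerivAt_slowKernelDeriv h t).congr_deriv ?_
  have : slowPeriod / slowPeriod = 1 := div_self slowPeriod_pos.ne'
  rw [periodicConv_sub_kernel, periodicConv_smul_kernel, periodicConv_smul_kernel,
    periodicConv_cosKernel, hc, hs]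
  simp [slowKernelDeriv, this, slowFreq_mul_slowPeriod]
  ring

theorem hasDerivAt_fastResponse (t : ℝ) :
    HasDerivAt (fun t : ℝ => periodicConv fastKernel h (t : AddCircle slowPeriod))
      (periodicConv fastKernelDeriv h (t : AddCircle slowPeriod)) t := by
  refine (hasDerivAt_periodicConv hasDerivAt_fastKernel h t).congr_deriv ?_
  have h1 : fastKernel 0 = fastKernel slowPeriod := by
    simp only [fastKernel, ContinuousMap.coe_mk]
    rw [show fastFreq * (0 - slowPeriod / 2) = -(fastFreq * (slowPeriod - slowPeriod / 2)) by ring,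
      Real.cos_neg]
  rw [h1, sub_self, zero_mul, add_zero]

theorem hasDerivAt_fastResponseDeriv (t : ℝ) :
    HasDerivAt (fun t : ℝ => periodicConv fastKernelDeriv h (t : AddCircle slowPeriod))
      (h (t : AddCircle slowPeriod) -
        fastFreq ^ 2 * periodicConv fastKernel h (t : AddCircle slowPeriod)) t := by
  refine (hasDerivAt_periodicConv (g' := -fastFreq ^ 2 • fastKernel)
    hasDerivAt_fastKernelDeriv h t).congr_deriv ?_
  have h1 : fastKernelDeriv 0 - fastKernelDeriv slowPeriod = 1 := by
    have := sin_fastFreq_mul_half_slowPeriod_ne_zero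
    simp only [fastKernelDeriv, ContinuousMap.coe_mk]
    rw [show fastFreq * (0 - slowPeriod / 2) = -(fastFreq * (slowPeriod / 2)) by ring,
      show fastFreq * (slowPeriod - slowPeriod / 2) = fastFreq * (slowPeriod / 2) by ring,
      Real.sin_neg]
    generalize Real.sin (fastFreq * (slowPeriod / 2)) = σ at this ⊢
    field_simp
    norm_num
  rw [periodicConv_smul_kernel, h1]
  ring

end Oscillators

section Response

variable (a b ε : ℝ) (h : C(AddCircle slowPeriod, ℝ))

/-- First angle of the periodic response to the force `h` on the second pendulum. -/
noncomputable def angle₁ : C(AddCircle slowPeriod, ℝ) :=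
  a • cosCircle + b • sinCircle +
    (ε / (2 * √2)) • (periodicConv slowKernel h - periodicConv fastKernel h)

/-- Second angle of the periodic response to the force `h` on the second pendulum. -/
noncomputable def angle₂ : C(AddCircle slowPeriod, ℝ) :=
  √2 • (a • cosCircle + b • sinCircle) +
    (ε / 2) • (periodicConv slowKernel h + periodicConv fastKernel h)

/-- First angular velocity of the periodic response. -/
noncomputable def velocity₁ : C(AddCircle slowPeriod, ℝ) :=
  slowFreq • (b • cosCircle - a • sinCircle) +
    (ε / (2 * √2)) • (periodicConv slowKernelDeriv h - periodicConv fastKernelDeriv h)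

/-- Second angular velocity of the periodic response. -/
noncomputable def velocity₂ : C(AddCircle slowPeriod, ℝ) :=
  √2 • slowFreq • (b • cosCircle - a • sinCircle) +
    (ε / 2) • (periodicConv slowKernelDeriv h + periodicConv fastKernelDeriv h)

theorem hasDerivAt_angle₁ (t : ℝ) :
    HasDerivAt (fun t : ℝ => angle₁ a b ε h t) (velocity₁ a b ε h t) t := by
  have h1 := (((hasDerivAt_cos_mul slowFreq t).const_mul a).add
    ((hasDerivAt_sin_mul slowFreq t).const_mul b)).add
    (((hasDerivAt_slowResponse h t).sub (hasDerivAt_fastResponse h t)).const_mul (ε / (2 * √2)))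
  refine h1.congr_deriv ?_
  simp only [velocity₁, ContinuousMap.add_apply, ContinuousMap.sub_apply, ContinuousMap.smul_apply,
    smul_eq_mul, cosCircle_coe, sinCircle_coe]
  ring

theorem hasDerivAt_angle₂ (t : ℝ) :
    HasDerivAt (fun t : ℝ => angle₂ a b ε h t) (velocity₂ a b ε h t) t := by
  have h1 := ((((hasDerivAt_cos_mul slowFreq t).const_mul a).add
    ((hasDerivAt_sin_mul slowFreq t).const_mul b)).const_mul √2).add
    (((hasDerivAt_slowResponse h t).add (hasDerivAt_fastResponse h t)).const_mul (ε / 2))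
  refine h1.congr_deriv ?_
  simp only [velocity₂, ContinuousMap.add_apply, ContinuousMap.sub_apply, ContinuousMap.smul_apply,
    smul_eq_mul, cosCircle_coe, sinCircle_coe]
  ring

theorem hasDerivAt_velocity₁ (hc : cosCoeff h = 0) (hs : sinCoeff h = 0) (t : ℝ) :
    HasDerivAt (fun t : ℝ => velocity₁ a b ε h t)
      (-2 * angle₁ a b ε h t + angle₂ a b ε h t) t := by
  have h1 := ((((hasDerivAt_cos_mul slowFreq t).const_mul b).sub
    ((hasDerivAt_sin_mul slowFreq t).const_mul a)).const_mul slowFreq).add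
    (((hasDerivAt_slowResponseDeriv h hc hs t).sub
      (hasDerivAt_fastResponseDeriv h t)).const_mul (ε / (2 * √2)))
  refine h1.congr_deriv ?_
  have h2 : √2 ≠ (0 : ℝ) := by positivity
  simp only [angle₁, angle₂, ContinuousMap.add_apply, ContinuousMap.sub_apply,
    ContinuousMap.smul_apply, smul_eq_mul, cosCircle_coe, sinCircle_coe, fastFreq_sq, slowFreq_sq]
  have h3 : ε / 2 = ε / (2 * √2) * √2 := by field_simp
  rw [h3]
  linear_combination -(a * Real.cos (slowFreq * t) + b * Real.sin (slowFreq * t)) * slowFreq_sq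

theorem hasDerivAt_velocity₂ (hc : cosCoeff h = 0) (hs : sinCoeff h = 0) (t : ℝ) :
    HasDerivAt (fun t : ℝ => velocity₂ a b ε h t)
      (2 * angle₁ a b ε h t - 2 * angle₂ a b ε h t + ε * h t) t := by
  have h1 := (((((hasDerivAt_cos_mul slowFreq t).const_mul b).sub
    ((hasDerivAt_sin_mul slowFreq t).const_mul a)).const_mul slowFreq).const_mul √2).add
    (((hasDerivAt_slowResponseDeriv h hc hs t).add
      (hasDerivAt_fastResponseDeriv h t)).const_mul (ε / 2))
  refine h1.congr_deriv ?_
  have h2 : √2 ≠ (0 : ℝ) := by positivity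
  simp only [angle₁, angle₂, ContinuousMap.add_apply, ContinuousMap.sub_apply,
    ContinuousMap.smul_apply, smul_eq_mul, cosCircle_coe, sinCircle_coe, fastFreq_sq, slowFreq_sq]
  have h3 : ε / 2 = ε / (2 * √2) * √2 := by field_simp
  rw [h3]
  linear_combination -√2 * (a * Real.cos (slowFreq * t) + b * Real.sin (slowFreq * t)) * slowFreq_sq
    + (a * Real.cos (slowFreq * t) + b * Real.sin (slowFreq * t)) * sqrt_two_mul_self
    + ε / (2 * √2) * (periodicConv fastKernel h t - periodicConv slowKernel h t) *
      sqrt_two_mul_self * (-1) + -2 * h t * h3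

theorem deriv_angle₁ : deriv (fun t : ℝ => angle₁ a b ε h t) = fun t : ℝ => velocity₁ a b ε h t :=
  funext fun t => (hasDerivAt_angle₁ a b ε h t).deriv

theorem deriv_angle₂ : deriv (fun t : ℝ => angle₂ a b ε h t) = fun t : ℝ => velocity₂ a b ε h t :=
  funext fun t => (hasDerivAt_angle₂ a b ε h t).deriv

theorem isSolution_angle (hc : cosCoeff h = 0) (hs : sinCoeff h = 0)
    (hh : ∀ t : ℝ, ε * h t =
      ε * ((1 - angle₁ a b ε h t ^ 2) * Real.sin (slowFreq * t))) :
    IsSolution pert₁ pert₂ ε (fun t : ℝ => angle₁ a b ε h t) (fun t : ℝ => angle₂ a b ε h t) := by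
  refine ⟨fun t => (hasDerivAt_angle₁ a b ε h t).differentiableAt,
    fun t => (hasDerivAt_angle₂ a b ε h t).differentiableAt, fun t => ⟨?_, ?_⟩⟩
  · rw [deriv_angle₁]
    refine (hasDerivAt_velocity₁ a b ε h hc hs t).congr_deriv ?_
    simp [pert₁]
  · rw [deriv_angle₂]
    refine (hasDerivAt_velocity₂ a b ε h hc hs t).congr_deriv ?_
    rw [hh]
    rfl

theorem periodic_coe_circle {T : ℝ} (f : C(AddCircle T, ℝ)) :
    Function.Periodic (fun t : ℝ => f (t : AddCircle T)) T := fun t => by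
  simp

end Response

section Moments

theorem integral_trig_quartic (p q r u v : ℝ) :
    ∫ s in (0 : ℝ)..slowPeriod,
      (p * Real.sin (slowFreq * s) ^ 2 + q * (Real.sin (slowFreq * s) * Real.cos (slowFreq * s) ^ 3)
        + r * (Real.sin (slowFreq * s) ^ 2 * Real.cos (slowFreq * s) ^ 2)
        + u * (Real.sin (slowFreq * s) ^ 3 * Real.cos (slowFreq * s))
        + v * Real.sin (slowFreq * s) ^ 4) = slowPeriod / 8 * (4 * p + r + 3 * v) := by
  have hd (s : ℝ) : HasDerivAt (fun s =>
      (p / 2 + r / 8 + 3 * v / 8) * s + slowFreq⁻¹ * (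
        -(p / 2 + r / 8 + 3 * v / 8) * (Real.sin (slowFreq * s) * Real.cos (slowFreq * s))
        - q / 4 * Real.cos (slowFreq * s) ^ 4 + u / 4 * Real.sin (slowFreq * s) ^ 4
        + (r - v) / 4 * (Real.sin (slowFreq * s) ^ 3 * Real.cos (slowFreq * s))))
      (p * Real.sin (slowFreq * s) ^ 2 + q * (Real.sin (slowFreq * s) * Real.cos (slowFreq * s) ^ 3)
        + r * (Real.sin (slowFreq * s) ^ 2 * Real.cos (slowFreq * s) ^ 2)
        + u * (Real.sin (slowFreq * s) ^ 3 * Real.cos (slowFreq * s))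
        + v * Real.sin (slowFreq * s) ^ 4) s := by
    have hS := hasDerivAt_sin_mul slowFreq s
    have hC := hasDerivAt_cos_mul slowFreq s
    refine (((hasDerivAt_id s).const_mul (p / 2 + r / 8 + 3 * v / 8)).add
      ((((((hS.mul hC).const_mul (-(p / 2 + r / 8 + 3 * v / 8))).sub
        ((hC.pow 4).const_mul (q / 4))).add ((hS.pow 4).const_mul (u / 4))).add
        (((hS.pow 3).mul hC).const_mul ((r - v) / 4))).const_mul slowFreq⁻¹)).congr_deriv ?_
    have hw := slowFreq_ne_zero
    have hp := Real.sin_sq_add_cos_sq (slowFreq * s)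
    simp only [Pi.pow_apply]
    generalize Real.sin (slowFreq * s) = S at *
    generalize Real.cos (slowFreq * s) = C at *
    have hC2 : C ^ 2 = 1 - S ^ 2 := by linear_combination hp
    field_simp
    push_cast
    simp only [show C ^ 3 = C * C ^ 2 by ring, hC2]
    ring
  rw [intervalIntegral.integral_eq_sub_of_hasDerivAt (fun s _ => hd s)
    (Continuous.intervalIntegrable (by fun_prop) _ _), slowFreq_mul_slowPeriod]
  simp
  ring

theorem sinCircle_neg (s : ℝ) :
    sinCircle ((-s : ℝ) : AddCircle slowPeriod) = -Real.sin (slowFreq * s) := by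
  rw [sinCircle_coe, mul_neg, Real.sin_neg]

theorem cosCircle_neg (s : ℝ) :
    cosCircle ((-s : ℝ) : AddCircle slowPeriod) = Real.cos (slowFreq * s) := by
  rw [cosCircle_coe, mul_neg, Real.cos_neg]

/-- The slow-mode angle `a cos(ω t) + b sin(ω t)`. -/
noncomputable def mode (a b : ℝ) : C(AddCircle slowPeriod, ℝ) := a • cosCircle + b • sinCircle

/-- The force `(1 - x²) sin(ω t)` produced by the angle `x`. -/
noncomputable def forcing (x : C(AddCircle slowPeriod, ℝ)) : C(AddCircle slowPeriod, ℝ) :=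
  (1 - x ^ 2) * sinCircle

theorem cosCoeff_forcing_mode (a b : ℝ) :
    cosCoeff (forcing (mode a b)) = -(slowPeriod / 4 * (a * b)) := by
  have h := integral_trig_quartic 0 (a ^ 2) (-2 * a * b) (b ^ 2) 0
  have h0 : ∫ s in (0 : ℝ)..slowPeriod, Real.sin (slowFreq * s) * Real.cos (slowFreq * s) = 0 := by
    have := intervalIntegral.integral_comp_mul_left (a := 0) (b := slowPeriod)
      (fun x => Real.sin x * Real.cos x) slowFreq_ne_zero
    rw [this, slowFreq_mul_slowPeriod]
    simp
  have h1 : cosCoeff (forcing (mode a b)) = (∫ s in (0 : ℝ)..slowPeriod,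
      (0 * Real.sin (slowFreq * s) ^ 2
        + a ^ 2 * (Real.sin (slowFreq * s) * Real.cos (slowFreq * s) ^ 3)
        + (-2 * a * b) * (Real.sin (slowFreq * s) ^ 2 * Real.cos (slowFreq * s) ^ 2)
        + b ^ 2 * (Real.sin (slowFreq * s) ^ 3 * Real.cos (slowFreq * s))
        + 0 * Real.sin (slowFreq * s) ^ 4)) -
      ∫ s in (0 : ℝ)..slowPeriod, Real.sin (slowFreq * s) * Real.cos (slowFreq * s) := by
    rw [cosCoeff_apply, ← intervalIntegral.integral_sub
      (Continuous.intervalIntegrable (by fun_prop) _ _)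
      (Continuous.intervalIntegrable (by fun_prop) _ _)]
    congr 1
    ext s
    simp only [forcing, mode, ContinuousMap.mul_apply, ContinuousMap.sub_apply,
      ContinuousMap.one_apply, ContinuousMap.pow_apply, ContinuousMap.add_apply,
      ContinuousMap.smul_apply, smul_eq_mul, sinCircle_neg, cosCircle_neg]
    ring
  rw [h1, h, h0]
  ring

theorem sinCoeff_forcing_mode (a b : ℝ) :
    sinCoeff (forcing (mode a b)) = -(slowPeriod / 8 * (4 - a ^ 2 - 3 * b ^ 2)) := by
  have h := integral_trig_quartic (-1) 0 (a ^ 2) (-2 * a * b) (b ^ 2)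
  calc _ = _ := by
        rw [sinCoeff_apply]
        congr 1
        ext s
        simp only [forcing, mode, ContinuousMap.mul_apply, ContinuousMap.sub_apply,
          ContinuousMap.one_apply, ContinuousMap.pow_apply, ContinuousMap.add_apply,
          ContinuousMap.smul_apply, smul_eq_mul, sinCircle_neg, cosCircle_neg]
        ring
    _ = _ := h
    _ = _ := by ring

theorem cosCoeff_mode_mul_mode (a b c d : ℝ) :
    cosCoeff (mode a b * mode c d * sinCircle) = slowPeriod / 8 * (a * d + b * c) := by
  have h := integral_trig_quartic 0 (-(a * c)) (a * d + b * c) (-(b * d)) 0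
  calc _ = _ := by
        rw [cosCoeff_apply]
        congr 1
        ext s
        simp only [mode, ContinuousMap.mul_apply, ContinuousMap.add_apply,
          ContinuousMap.smul_apply, smul_eq_mul, sinCircle_neg, cosCircle_neg]
        ring
    _ = _ := h
    _ = _ := by ring

theorem sinCoeff_mode_mul_mode (a b c d : ℝ) :
    sinCoeff (mode a b * mode c d * sinCircle) = -(slowPeriod / 8 * (a * c + 3 * b * d)) := by
  have h := integral_trig_quartic 0 0 (-(a * c)) (a * d + b * c) (-(b * d))
  calc _ = _ := by
        rw [sinCoeff_apply]
        congr 1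
        ext s
        simp only [mode, ContinuousMap.mul_apply, ContinuousMap.add_apply,
          ContinuousMap.smul_apply, smul_eq_mul, sinCircle_neg, cosCircle_neg]
        ring
    _ = _ := h
    _ = _ := by ring

end Moments

section Bifurcation

/-- Zeros `(ε, a, b, x)` of this map are the slow-periodic solutions with parameter `ε`, first angle
`x` and slow-mode parameters `(a, b)`. -/
noncomputable def bifurcationMap (p : ℝ × (ℝ × ℝ × C(AddCircle slowPeriod, ℝ))) :
    ℝ × ℝ × C(AddCircle slowPeriod, ℝ) :=
  (cosCoeff (forcing p.2.2.2), sinCoeff (forcing p.2.2.2),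
    p.2.2.2 - angle₁ p.2.1 p.2.2.1 p.1 (forcing p.2.2.2))

theorem contDiff_forcing : ContDiff ℝ 1 forcing := by
  unfold forcing
  fun_prop

theorem contDiff_bifurcationMap : ContDiff ℝ 1 bifurcationMap := by
  have h : ContDiff ℝ 1 fun p : ℝ × (ℝ × ℝ × C(AddCircle slowPeriod, ℝ)) => forcing p.2.2.2 :=
    contDiff_forcing.comp (by fun_prop)
  unfold bifurcationMap angle₁
  fun_prop

theorem angle₁_zero_param (a b : ℝ) (h : C(AddCircle slowPeriod, ℝ)) :
    angle₁ a b 0 h = mode a b := by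
  simp [angle₁, mode]

theorem bifurcationMap_mode {a b : ℝ} (h₁ : a * b = 0) (h₂ : a ^ 2 + 3 * b ^ 2 = 4) :
    bifurcationMap (0, a, b, mode a b) = 0 := by
  have h3 : 4 - a ^ 2 - 3 * b ^ 2 = 0 := by linear_combination -h₂
  simp [bifurcationMap, cosCoeff_forcing_mode, sinCoeff_forcing_mode, h₁, h3, angle₁_zero_param]

theorem forcing_add_smul (x y : C(AddCircle slowPeriod, ℝ)) (t : ℝ) :
    forcing (x + t • y) =
      forcing x + t • ((-2 : ℝ) • (x * y * sinCircle)) + t ^ 2 • (-(y ^ 2 * sinCircle)) := by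
  ext s
  simp only [forcing, ContinuousMap.mul_apply, ContinuousMap.sub_apply,
    ContinuousMap.one_apply, ContinuousMap.pow_apply, ContinuousMap.add_apply,
    ContinuousMap.smul_apply, smul_eq_mul, ContinuousMap.neg_apply]
  ring

theorem fderiv_bifurcationMap_inr (a b c d : ℝ) (x y : C(AddCircle slowPeriod, ℝ)) :
    fderiv ℝ bifurcationMap (0, a, b, x) (0, c, d, y) =
      (-2 * cosCoeff (x * y * sinCircle), -2 * sinCoeff (x * y * sinCircle), y - mode c d) := by
  have hline : HasDerivAt (fun t : ℝ => ((0, a, b, x) : ℝ × (ℝ × ℝ × C(AddCircle slowPeriod, ℝ))) +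
      t • (0, c, d, y)) (0, c, d, y) 0 := by
    simpa using ((hasDerivAt_id (0 : ℝ)).smul_const
      ((0, c, d, y) : ℝ × (ℝ × ℝ × C(AddCircle slowPeriod, ℝ)))).const_add (0, a, b, x)
  have hf : HasFDerivAt bifurcationMap (fderiv ℝ bifurcationMap (0, a, b, x))
      (((0, a, b, x) : ℝ × (ℝ × ℝ × C(AddCircle slowPeriod, ℝ))) + (0 : ℝ) • (0, c, d, y)) := by
    rw [zero_smul, add_zero]
    exact (contDiff_bifurcationMap.differentiable one_ne_zero _).hasFDerivAt
  have h1 := hf.comp_hasDerivAt (0 : ℝ) hline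
  have hpoly {F : Type} [NormedAddCommGroup F] [NormedSpace ℝ F] (u v w : F) :
      HasDerivAt (fun t : ℝ => u + t • v + t ^ 2 • w) v 0 := by
    have := (((hasDerivAt_id (0 : ℝ)).smul_const v).const_add u).add
      (((hasDerivAt_id (0 : ℝ)).pow 2).smul_const w)
    simpa using! this
  have h2 : HasDerivAt (bifurcationMap ∘ fun t : ℝ =>
      ((0, a, b, x) : ℝ × (ℝ × ℝ × C(AddCircle slowPeriod, ℝ))) + t • (0, c, d, y))
      (-2 * cosCoeff (x * y * sinCircle), -2 * sinCoeff (x * y * sinCircle), y - mode c d) 0 := by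
    have h3 := (hpoly (cosCoeff (forcing x)) (-2 * cosCoeff (x * y * sinCircle))
      (cosCoeff (-(y ^ 2 * sinCircle)))).prodMk
      ((hpoly (sinCoeff (forcing x)) (-2 * sinCoeff (x * y * sinCircle))
      (sinCoeff (-(y ^ 2 * sinCircle)))).prodMk (hpoly (x - mode a b) (y - mode c d) 0))
    refine h3.congr_of_eventuallyEq (Eventually.of_forall fun t => ?_)
    simp only [Function.comp_apply, bifurcationMap, Prod.smul_mk, Prod.mk_add_mk, smul_zero,
      add_zero, forcing_add_smul, map_add, map_smul, smul_eq_mul, mul_zero, angle₁_zero_param]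
    refine Prod.ext rfl (Prod.ext rfl ?_)
    simp only [mode]
    module
  exact h1.unique h2

theorem isInvertible_fderiv_bifurcationMap {a b : ℝ} (h : a ^ 2 ≠ 3 * b ^ 2) :
    (fderiv ℝ bifurcationMap (0, a, b, mode a b) ∘L
      .inr ℝ ℝ (ℝ × ℝ × C(AddCircle slowPeriod, ℝ))).IsInvertible := by
  set D := fderiv ℝ bifurcationMap (0, a, b, mode a b) ∘L
      .inr ℝ ℝ (ℝ × ℝ × C(AddCircle slowPeriod, ℝ)) with hD
  have hDa (c d : ℝ) (y : C(AddCircle slowPeriod, ℝ)) : D (c, d, y) =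
      (-2 * cosCoeff (mode a b * y * sinCircle), -2 * sinCoeff (mode a b * y * sinCircle),
        y - mode c d) := fderiv_bifurcationMap_inr a b c d (mode a b) y
  have hT : slowPeriod ≠ 0 := slowPeriod_pos.ne'
  have hdet : a ^ 2 - 3 * b ^ 2 ≠ 0 := sub_ne_zero.2 h
  refine ⟨ContinuousLinearEquiv.ofBijective D ?_ ?_, ContinuousLinearEquiv.coe_ofBijective _ _ _⟩
  · rw [LinearMap.ker_eq_bot']
    rintro ⟨c, d, y⟩ h0
    have h0 : D (c, d, y) = 0 := h0
    simp only [hDa, Prod.mk_eq_zero] at h0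
    obtain ⟨h1, h2, h3⟩ := h0
    obtain rfl := sub_eq_zero.1 h3
    rw [cosCoeff_mode_mul_mode] at h1
    rw [sinCoeff_mode_mul_mode] at h2
    have h1' : a * d + b * c = 0 := by
      refine (mul_eq_zero.1 ?_).resolve_left hT
      linear_combination -4 * h1
    have h2' : a * c + 3 * b * d = 0 := by
      refine (mul_eq_zero.1 ?_).resolve_left hT
      linear_combination 4 * h2
    have hc : c = 0 := (mul_eq_zero.1 (by linear_combination a * h2' - 3 * b * h1' :
      (a ^ 2 - 3 * b ^ 2) * c = 0)).resolve_left hdet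
    have hd : d = 0 := (mul_eq_zero.1 (by linear_combination a * h1' - b * h2' :
      (a ^ 2 - 3 * b ^ 2) * d = 0)).resolve_left hdet
    simp [hc, hd, mode]
  · rw [LinearMap.range_eq_top]
    rintro ⟨p, q, z⟩
    set p' := -4 * (p + 2 * cosCoeff (mode a b * z * sinCircle)) / slowPeriod with hp'
    set q' := 4 * (q + 2 * sinCoeff (mode a b * z * sinCircle)) / slowPeriod with hq'
    obtain ⟨c, d, hc, hd⟩ : ∃ c d : ℝ, a * d + b * c = p' ∧ a * c + 3 * b * d = q' :=
      ⟨(a * q' - 3 * b * p') / (a ^ 2 - 3 * b ^ 2), (a * p' - b * q') / (a ^ 2 - 3 * b ^ 2),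
        by linear_combination p' * mul_inv_cancel₀ hdet,
        by linear_combination q' * mul_inv_cancel₀ hdet⟩
    refine ⟨(c, d, z + mode c d), (hDa _ _ _).trans ?_⟩
    rw [mul_add, add_mul, map_add, map_add, cosCoeff_mode_mul_mode, sinCoeff_mode_mul_mode,
      add_sub_cancel_right, hc, hd, hp', hq']
    refine Prod.ext ?_ (Prod.ext ?_ rfl)
    · simp only
      field_simp
      ring
    · simp only
      field_simp
      ring

theorem exists_branch_bifurcationMap {a b : ℝ} (h₁ : a * b = 0) (h₂ : a ^ 2 + 3 * b ^ 2 = 4)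
    (h₃ : a ^ 2 ≠ 3 * b ^ 2) :
    ∃ ψ : ℝ → ℝ × ℝ × C(AddCircle slowPeriod, ℝ), Tendsto ψ (𝓝 0) (𝓝 (a, b, mode a b)) ∧
      ∀ᶠ ε in 𝓝 (0 : ℝ), bifurcationMap (ε, ψ ε) = 0 := by
  have hs : HasStrictFDerivAt bifurcationMap (fderiv ℝ bifurcationMap (0, a, b, mode a b))
      (0, a, b, mode a b) := contDiff_bifurcationMap.contDiffAt.hasStrictFDerivAt one_ne_zero
  have hi := isInvertible_fderiv_bifurcationMap h₃
  refine ⟨hs.implicitFunctionOfProdDomain hi, hs.tendsto_implicitFunctionOfProdDomain hi, ?_⟩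
  rw [← bifurcationMap_mode h₁ h₂]
  exact hs.eventually_apply_implicitFunctionOfProdDomain hi

end Bifurcation

section Orbits

theorem slowOrbit₁_eq (a b : ℝ) : slowOrbit₁ (√2 * slowFreq * a) (√2 * slowFreq * b) =
    fun t : ℝ => angle₁ a b 0 0 t := by
  ext t
  have h : √(4 - 2 * √2) = √2 * slowFreq := by
    rw [slowFreq, ← Real.sqrt_mul zero_le_two]
    ring_nf
  have h2 : √2 ≠ (0 : ℝ) := by positivity
  have h3 := slowFreq_ne_zero
  rw [angle₁_zero_param]
  simp only [slowOrbit₁, h, mode, ContinuousMap.add_apply, ContinuousMap.smul_apply, smul_eq_mul,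
    cosCircle_coe, sinCircle_coe]
  field_simp

theorem slowOrbit₂_eq (a b : ℝ) : slowOrbit₂ (√2 * slowFreq * a) (√2 * slowFreq * b) =
    fun t : ℝ => angle₂ a b 0 0 t := by
  ext t
  have h3 := slowFreq_ne_zero
  rw [slowOrbit₂, ← slowFreq]
  simp only [angle₂, ContinuousMap.add_apply, ContinuousMap.smul_apply, smul_eq_mul,
    cosCircle_coe, sinCircle_coe, zero_div, zero_mul, add_zero]
  field_simp

theorem angle₁_coe_zero_param (a b t : ℝ) : angle₁ a b 0 0 (t : AddCircle slowPeriod) =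
    a * Real.cos (slowFreq * t) + b * Real.sin (slowFreq * t) := by
  rw [angle₁_zero_param]
  rfl

theorem isPeriodicSolution_slowOrbit {a b : ℝ} (hab : a ≠ 0 ∨ b ≠ 0) :
    IsPeriodicSolution pert₁ pert₂ 0 slowPeriod
      (slowOrbit₁ (√2 * slowFreq * a) (√2 * slowFreq * b))
      (slowOrbit₂ (√2 * slowFreq * a) (√2 * slowFreq * b)) := by
  rw [slowOrbit₁_eq, slowOrbit₂_eq]
  refine ⟨slowPeriod_pos, isSolution_angle a b 0 0 (map_zero _) (map_zero _) (by simp),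
    periodic_coe_circle _, periodic_coe_circle _, ?_⟩
  rintro ⟨u, v, huv⟩
  have hval (x : ℝ) : a * Real.cos x + b * Real.sin x = u := by
    have := (huv (x / slowFreq)).1
    beta_reduce at this
    rwa [angle₁_coe_zero_param, mul_div_cancel₀ _ slowFreq_ne_zero] at this
  have h0 := hval 0
  have h1 := hval Real.pi
  have h2 := hval (Real.pi / 2)
  simp only [Real.cos_zero, Real.sin_zero, Real.cos_pi, Real.sin_pi, Real.cos_pi_div_two,
    Real.sin_pi_div_two] at h0 h1 h2
  rcases hab with h | h <;> exact h (by linarith)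

theorem tendstoUniformly_response
    {Y : ℝ → ℝ → ℝ → C(AddCircle slowPeriod, ℝ) → C(AddCircle slowPeriod, ℝ)}
    (hY : Continuous fun p : (ℝ × ℝ) × (ℝ × C(AddCircle slowPeriod, ℝ)) =>
      Y p.1.1 p.1.2 p.2.1 p.2.2)
    (hY0 : ∀ a b h, Y a b 0 h = Y a b 0 0) {a b : ℝ} {h₀ : C(AddCircle slowPeriod, ℝ)}
    {A B : ℝ → ℝ} {h : ℝ → C(AddCircle slowPeriod, ℝ)} (hA : Tendsto A (𝓝 0) (𝓝 a))
    (hB : Tendsto B (𝓝 0) (𝓝 b)) (hh : Tendsto h (𝓝 0) (𝓝 h₀)) :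
    TendstoUniformly (fun ε (t : ℝ) => Y (A ε) (B ε) ε (h ε) (t : AddCircle slowPeriod))
      (fun t : ℝ => Y a b 0 0 (t : AddCircle slowPeriod)) (𝓝[≠] 0) := by
  have h1 : Tendsto (fun ε => Y (A ε) (B ε) ε (h ε)) (𝓝 0) (𝓝 (Y a b 0 0)) := by
    rw [← hY0 a b h₀]
    exact (hY.tendsto ((a, b), (0, h₀))).comp
      ((hA.prodMk_nhds hB).prodMk_nhds (tendsto_id.prodMk_nhds hh))
  exact (ContinuousMap.tendsto_iff_tendstoUniformly.1 (h1.mono_left nhdsWithin_le_nhds)).comp _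

theorem forcing_coe (x : C(AddCircle slowPeriod, ℝ)) (t : ℝ) :
    forcing x (t : AddCircle slowPeriod) =
      (1 - x (t : AddCircle slowPeriod) ^ 2) * Real.sin (slowFreq * t) := rfl

theorem exists_solution_branch {a b : ℝ} (h₁ : a * b = 0) (h₂ : a ^ 2 + 3 * b ^ 2 = 4)
    (h₃ : a ^ 2 ≠ 3 * b ^ 2) :
    ∃ θ₁ θ₂ : ℝ → ℝ → ℝ,
      (∀ᶠ ε in 𝓝[≠] (0 : ℝ), IsSolution pert₁ pert₂ ε (θ₁ ε) (θ₂ ε) ∧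
        Function.Periodic (θ₁ ε) slowPeriod ∧ Function.Periodic (θ₂ ε) slowPeriod) ∧
      TendsToSlowOrbit θ₁ θ₂ (√2 * slowFreq * a) (√2 * slowFreq * b) := by
  obtain ⟨ψ, hψ, hzero⟩ := exists_branch_bifurcationMap h₁ h₂ h₃
  refine ⟨fun ε t => angle₁ (ψ ε).1 (ψ ε).2.1 ε (forcing (ψ ε).2.2) t,
    fun ε t => angle₂ (ψ ε).1 (ψ ε).2.1 ε (forcing (ψ ε).2.2) t, ?_, ?_⟩
  · filter_upwards [nhdsWithin_le_nhds hzero] with ε hε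
    generalize ψ ε = z at hε ⊢
    obtain ⟨A, B, x⟩ := z
    simp only [bifurcationMap, Prod.mk_eq_zero] at hε ⊢
    obtain ⟨hc, hs, hx⟩ := hε
    refine ⟨isSolution_angle A B ε (forcing x) hc hs fun t => ?_, periodic_coe_circle _,
      periodic_coe_circle _⟩
    rw [(sub_eq_zero.1 hx).symm, forcing_coe]
  · have hA := hψ.fst_nhds
    have hB := hψ.snd_nhds.fst_nhds
    have hh := (contDiff_forcing.continuous.tendsto _).comp hψ.snd_nhds.snd_nhds
    refine ⟨?_, ?_, ?_, ?_⟩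
    · rw [slowOrbit₁_eq]
      exact tendstoUniformly_response (Y := angle₁)
        (by unfold angle₁; fun_prop) (by simp [angle₁]) hA hB hh
    · rw [slowOrbit₁_eq]
      simp only [deriv_angle₁]
      exact tendstoUniformly_response (Y := velocity₁)
        (by unfold velocity₁; fun_prop) (by simp [velocity₁]) hA hB hh
    · rw [slowOrbit₂_eq]
      exact tendstoUniformly_response (Y := angle₂)
        (by unfold angle₂; fun_prop) (by simp [angle₂]) hA hB hh
    · rw [slowOrbit₂_eq]
      simp only [deriv_angle₂]
      exact tendstoUniformly_response (Y := velocity₂)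
        (by unfold velocity₂; fun_prop) (by simp [velocity₂]) hA hB hh

theorem TendsToSlowOrbit.eventually_near {θ₁ θ₂ : ℝ → ℝ → ℝ} {a b : ℝ}
    (h : TendsToSlowOrbit θ₁ θ₂ (√2 * slowFreq * a) (√2 * slowFreq * b)) {δ : ℝ} (hδ : 0 < δ) :
    ∀ᶠ ε in 𝓝[≠] (0 : ℝ), ∀ x : ℝ,
      |θ₁ ε (x / slowFreq) - (a * Real.cos x + b * Real.sin x)| < δ := by
  filter_upwards [Metric.tendstoUniformly_iff.1 h.1 δ hδ] with ε hε x
  have := hε (x / slowFreq)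
  rw [slowOrbit₁_eq] at this
  beta_reduce at this
  rwa [angle₁_coe_zero_param, mul_div_cancel₀ _ slowFreq_ne_zero, dist_comm,
    Real.dist_eq] at this

theorem two_mul_sqrt_eq : 2 * √(2 * (2 - √2)) = √2 * slowFreq * 2 := by
  rw [Real.sqrt_mul zero_le_two, slowFreq]
  ring

theorem two_mul_sqrt_two_thirds_eq :
    2 * √(2 / 3 * (2 - √2)) = √2 * slowFreq * (2 * √(1 / 3)) := by
  rw [Real.sqrt_mul (by norm_num), show (2 / 3 : ℝ) = 2 * (1 / 3) by norm_num,
    Real.sqrt_mul zero_le_two, slowFreq]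
  ring

end Orbits

end DoublePendulum

theorem corollary1 :
    -- the two limit orbits are periodic solutions of the unperturbed double pendulum
    DoublePendulum.IsPeriodicSolution DoublePendulum.pert₁ DoublePendulum.pert₂ 0
      DoublePendulum.slowPeriod
      (DoublePendulum.slowOrbit₁ (2 * √(2 * (2 - √2))) 0)
      (DoublePendulum.slowOrbit₂ (2 * √(2 * (2 - √2))) 0) ∧
    DoublePendulum.IsPeriodicSolution DoublePendulum.pert₁ DoublePendulum.pert₂ 0
      DoublePendulum.slowPeriod
      (DoublePendulum.slowOrbit₁ 0 (2 * √(2 / 3 * (2 - √2))))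
      (DoublePendulum.slowOrbit₂ 0 (2 * √(2 / 3 * (2 - √2)))) ∧
    -- and for small nonzero `ε` two periodic solutions `(α₁, α₂)` and `(β₁, β₂)`,
    -- not time translates of each other, tend to them
    ∃ ε₀ : ℝ, 0 < ε₀ ∧ ∃ α₁ α₂ β₁ β₂ : ℝ → ℝ → ℝ,
      (∀ ε : ℝ, ε ≠ 0 → |ε| < ε₀ →
        DoublePendulum.IsPeriodicSolution DoublePendulum.pert₁ DoublePendulum.pert₂ ε
          DoublePendulum.slowPeriod (α₁ ε) (α₂ ε) ∧
        DoublePendulum.IsPeriodicSolution DoublePendulum.pert₁ DoublePendulum.pert₂ ε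
          DoublePendulum.slowPeriod (β₁ ε) (β₂ ε) ∧
        ¬ ∃ s : ℝ, ∀ τ : ℝ, α₁ ε τ = β₁ ε (τ + s) ∧ α₂ ε τ = β₂ ε (τ + s)) ∧
      DoublePendulum.TendsToSlowOrbit α₁ α₂ (2 * √(2 * (2 - √2))) 0 ∧
      DoublePendulum.TendsToSlowOrbit β₁ β₂ 0 (2 * √(2 / 3 * (2 - √2))) := by
  open DoublePendulum Topology Filter in
  rw [two_mul_sqrt_eq, two_mul_sqrt_two_thirds_eq]
  set c : ℝ := 2 * √(1 / 3) with hc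
  have hc2 : c ^ 2 = 4 / 3 := by
    rw [hc, mul_pow, Real.sq_sqrt (by norm_num)]
    norm_num
  have hc0 : 0 ≤ c := by positivity
  have hc1 : 1 < c := by nlinarith
  have hc3 : c < 6 / 5 := by nlinarith
  have hαp := isPeriodicSolution_slowOrbit (a := 2) (b := 0) (.inl two_ne_zero)
  have hβp := isPeriodicSolution_slowOrbit (a := 0) (b := c) (.inr (zero_lt_one.trans hc1).ne')
  obtain ⟨α₁, α₂, hα, hαt⟩ := exists_solution_branch (a := 2) (b := 0) (by norm_num) (by norm_num)
    (by norm_num)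
  obtain ⟨β₁, β₂, hβ, hβt⟩ := exists_solution_branch (a := 0) (b := c) (by norm_num)
    (by linarith) (by linarith)
  have key : ∀ᶠ ε in 𝓝[≠] (0 : ℝ), IsPeriodicSolution pert₁ pert₂ ε slowPeriod (α₁ ε) (α₂ ε) ∧
      IsPeriodicSolution pert₁ pert₂ ε slowPeriod (β₁ ε) (β₂ ε) ∧
      ¬ ∃ s : ℝ, ∀ τ : ℝ, α₁ ε τ = β₁ ε (τ + s) ∧ α₂ ε τ = β₂ ε (τ + s) := by
    filter_upwards [hα, hβ, hαt.eventually_near (δ := 1 / 5) (by norm_num),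
      hβt.eventually_near (δ := 1 / 5) (by norm_num)] with ε ⟨hs, hp, hp'⟩ ⟨ks, kp, kp'⟩ hn kn
    have hn0 := abs_lt.1 (hn 0)
    have hn1 := abs_lt.1 (hn Real.pi)
    have kn0 := abs_lt.1 (kn 0)
    have kn1 := abs_lt.1 (kn (Real.pi / 2))
    simp only [Real.cos_zero, Real.sin_zero, Real.cos_pi, Real.sin_pi, Real.cos_pi_div_two,
      Real.sin_pi_div_two] at hn0 hn1 kn0 kn1
    refine ⟨⟨slowPeriod_pos, hs, hp, hp', ?_⟩, ⟨slowPeriod_pos, ks, kp, kp', ?_⟩, ?_⟩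
    · rintro ⟨u, v, huv⟩
      rw [(huv _).1] at hn0 hn1
      linarith [hn0.1, hn1.2]
    · rintro ⟨u, v, huv⟩
      rw [(huv _).1] at kn0 kn1
      linarith [kn0.2, kn1.1]
    · rintro ⟨s, hst⟩
      have h1 := (hst (0 / slowFreq)).1
      have h2 := abs_lt.1 (kn (slowFreq * (0 / slowFreq + s)))
      rw [mul_div_cancel_left₀ _ slowFreq_ne_zero, ← h1] at h2
      have h3 := mul_le_mul_of_nonneg_left
        (Real.sin_le_one (slowFreq * (0 / slowFreq + s))) hc0
      linarith [hn0.1, h2.2]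
  obtain ⟨ε₀, hε₀, hball⟩ := Metric.eventually_nhds_iff.1 (eventually_nhdsWithin_iff.1 key)
  rw [mul_zero] at hαp hβp hαt hβt
  exact ⟨hαp, hβp, ε₀, hε₀, α₁, α₂, β₁, β₂,
    fun ε hε hlt => hball (by rwa [Real.dist_eq, sub_zero]) hε, hαt, hβt⟩
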